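/- Let $\mathcal{G}$ be a loopless multigraph of order $n \ge 2$, $n \ne 4$ (that is, with $n$ vertices, parallel edges being allowed), and suppose that the maximum number of edges between any two vertices of $\mathcal{G}$ is $\lambda$, a non-negative integer. A \emph{harmonious total colouring} of $\mathcal{G}$ is a colouring of the vertices and the edges such that adjacent vertices, distinct edges with a common end, and incident vertices and edges receive different colours, and such that, in addition, the unordered pairs $\{c(v), c(e)\}$ of colours, taken over all pairs $(v,e)$ of a vertex $v$ and an edge $e$ incident with $v$, are pairwise different. Let $h_t(\mathcal{G})$, the \emph{harmonious total chromatic number} of $\mathcal{G}$, be the smallest number of colours in a harmonious total colouring of $\mathcal{G}$. Then $h_t(\mathcal{G})$ is finite and $$h_t(\mathcal{G}) \le (\lambda-1)\left(2\left\lceil \tfrac{n}{2}\right\rceil-1\right)+\left\lceil \tfrac{3n}{2}\right\rceil .$$ -/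

import Mathlib

namespace Graph

/-- The number of edges of the multigraph `G` joining `u` and `v`. -/
noncomputable def edgeMultiplicity {α β : Type*} (G : Graph α β) (u v : α) : ℕ∞ :=
  {e : β | G.IsLink e u v}.encard

/-- `m` is the maximum number of edges of `G` between two (distinct) vertices. -/
def IsMaxEdgeMultiplicity {α β : Type*} (G : Graph α β) (m : ℕ∞) : Prop :=
  IsGreatest {k : ℕ∞ | ∃ u ∈ G.vertexSet, ∃ v ∈ G.vertexSet, u ≠ v ∧ k = G.edgeMultiplicity u v} m

/-- A proper total colouring of the multigraph `G` with colours in `C`: `cV` colours the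
vertices and `cE` colours the edges. -/
structure IsProperTotalColouring {α β C : Type*} (G : Graph α β)
    (cV : G.vertexSet → C) (cE : G.edgeSet → C) : Prop where
  /-- Adjacent vertices receive different colours. -/
  vertex_ne : ∀ u v : G.vertexSet, G.Adj u v → cV u ≠ cV v
  /-- Distinct edges with a common end receive different colours. -/
  edge_ne : ∀ e f : G.edgeSet, e ≠ f →
    ∀ v : G.vertexSet, G.Inc e v → G.Inc f v → cE e ≠ cE f
  /-- An edge and each of its ends receive different colours. -/
  inc_ne : ∀ (v : G.vertexSet) (e : G.edgeSet), G.Inc e v → cV v ≠ cE e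

/-- A harmonious total colouring: a proper total colouring such that the unordered pairs of
colours on the incident vertex-edge pairs of `G` are pairwise different. -/
structure IsHarmoniousTotalColouring {α β C : Type*} (G : Graph α β)
    (cV : G.vertexSet → C) (cE : G.edgeSet → C) : Prop
    extends G.IsProperTotalColouring cV cE where
  harmonious : ∀ (u v : G.vertexSet) (e f : G.edgeSet), G.Inc e u → G.Inc f v →
    s(cV u, cE e) = s(cV v, cE f) → u = v ∧ e = f

/-- `G` has a harmonious total colouring with (at most) `k` colours. -/
def HarmoniouslyTotalColourable {α β : Type*} (G : Graph α β) (k : ℕ) : Prop :=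
  ∃ (cV : G.vertexSet → Fin k) (cE : G.edgeSet → Fin k), G.IsHarmoniousTotalColouring cV cE

/-- The harmonious total chromatic number of `G`: the smallest number of colours in a harmonious
total colouring of `G`, which is `⊤` if finitely many colours never suffice. -/
noncomputable def harmoniousTotalChromaticNumber {α β : Type*} (G : Graph α β) : ℕ∞ :=
  ⨅ k ∈ {k : ℕ | G.HarmoniouslyTotalColourable k}, (k : ℕ∞)

end Graph

/-! It suffices to colour the complete graph of order n. Its vertices get n distinct colours, and
its edges get these colours and ⌈n/2⌉ new ones. Each of the λ - 1 further layers of parallel edges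
gets a fresh copy of a proper edge colouring with 2⌈n/2⌉ - 1 colours
(`Graph.harmoniouslyTotalColourable_of_scheme`). As vertex colours are distinct, a pair of colours
can repeat in a proper colouring only if u colours an edge at v and v colours an edge at u. The
asymmetric relation `T` of a scheme forbids this.

Schemes live on two levels over a cyclic group of order p, with at most two further vertices. Edges
inside a level get new colours. An edge across the levels is coloured by a vertex above the midpoint
of its ends, on a level chosen by a sign with `pos (-d) = !pos d`; the sign makes `T` asymmetric.
For odd p this settles n = 2p. For n = 2p + 1 and n = 2p + 2 one class of cross edges takes another
new colour instead, and the vertex colours thus freed help to colour the edges at the further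
vertices. For n = 4k + 1 the group has even order and midpoints fail. Matchings `R w` replace the
pairs with midpoint w, and the signs come from 2-colouring the orbits of two involutions. -/

/-- A symmetric edge colouring of the complete graph on `V`, in which the edges at a vertex
have different colours. -/
structure IsProperEdgeColouring {V C : Type*} (χ : V → V → C) : Prop where
  symm : ∀ x y, χ x y = χ y x
  proper : ∀ x y z, x ≠ y → x ≠ z → χ x y = χ x z → y = z

/-- A harmonious total colouring of the complete graph on `V` in which every vertex is its own
colour and the edges have colours in `V ⊕ N`. The relation `T w x` contains all pairs such that
some edge at the vertex `x` has the colour `w`. -/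
structure IsHarmoniousScheme {V N : Type*} (φ : V → V → V ⊕ N) (T : V → V → Prop) : Prop
    extends IsProperEdgeColouring φ where
  covers : ∀ x y w, x ≠ y → φ x y = .inl w → T w x
  asymm : ∀ x y, T x y → ¬ T y x

/-! ### From complete graphs to multigraphs -/

/-- The labels split the edges into simple layers: `none` marks the layer coloured by the scheme,
the others those with fresh colours. If some edge exists then l ≥ 1, so `Option (Fin (l - 1))`
really has l elements. -/
lemma Graph.exists_labelling_of_edgeMultiplicity_le {α β : Type*} (G : Graph α β) [G.Loopless]
    (l : ℕ)
    (hl : ∀ u ∈ G.vertexSet, ∀ v ∈ G.vertexSet, u ≠ v → G.edgeMultiplicity u v ≤ l) :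
    ∃ lab : G.edgeSet → Option (Fin (l - 1)), ∀ (e f : G.edgeSet) (x y : α),
      G.IsLink e x y → G.IsLink f x y → lab e = lab f → e = f := by
  have key : ∀ s : Sym2 α, ∃ g : β → Option (Fin (l - 1)), ∀ e f x y, s = s(x, y) →
      G.IsLink e x y → G.IsLink f x y → g e = g f → e = f := by
    intro s
    induction s with | _ u v => ?_
    by_cases huv : ∃ e, G.IsLink e u v
    · obtain ⟨e₀, he₀⟩ := huv
      have hle := hl u he₀.left_mem v he₀.right_mem he₀.ne
      have hfin : {e : β | G.IsLink e u v}.Finite :=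
        Set.finite_of_encard_le_coe hle
      have := hfin.fintype
      have hcard : Fintype.card {e : β | G.IsLink e u v} ≤
          Fintype.card (Option (Fin (l - 1))) := by
        have h1 : {e : β | G.IsLink e u v}.encard ≤ l := hle
        rw [← Set.coe_fintypeCard] at h1
        have h2 : Fintype.card {e : β | G.IsLink e u v} ≤ l := by exact_mod_cast h1
        simp only [Fintype.card_option, Fintype.card_fin]
        omega
      obtain ⟨ι⟩ := Function.Embedding.nonempty_of_card_le hcard
      classical
      refine ⟨fun e => if h : G.IsLink e u v then ι ⟨e, h⟩ else none, ?_⟩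
      intro e f x y hs he hf hef
      have hiff : ∀ e, G.IsLink e x y → G.IsLink e u v := by
        intro e he
        rcases Sym2.eq_iff.1 hs with ⟨rfl, rfl⟩ | ⟨rfl, rfl⟩
        exacts [he, he.symm]
      have he' := hiff e he
      have hf' := hiff f hf
      simp only [he', hf', dif_pos] at hef
      simpa using ι.injective hef
    · refine ⟨fun _ => none, ?_⟩
      intro e f x y hs he hf _
      exfalso
      rcases Sym2.eq_iff.1 hs with ⟨rfl, rfl⟩ | ⟨rfl, rfl⟩
      exacts [huv ⟨e, he⟩, huv ⟨e, he.symm⟩]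
  choose g hg using key
  have hends : ∀ e : G.edgeSet, ∃ x y, G.IsLink e x y := fun e =>
    G.exists_isLink_of_mem_edgeSet e.2
  choose X Y hXY using hends
  refine ⟨fun e => g s(X e, Y e) e, ?_⟩
  intro e f x y he hf hef
  have h1 := (hXY e).isLink_iff_sym2_eq.1 he
  have h2 := (hXY f).isLink_iff_sym2_eq.1 hf
  refine Subtype.ext (hg s(x, y) e f x y rfl he hf ?_)
  simpa only [h1, h2] using hef

/-- A harmonious scheme on the vertex set, together with `l - 1` further copies of a proper edge
colouring, colours every loopless multigraph of multiplicity at most `l`. -/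
theorem Graph.harmoniouslyTotalColourable_of_scheme {α β V N C : Type*} [Fintype V] [Fintype N]
    [Fintype C] (G : Graph α β) [G.Loopless] (ν : G.vertexSet ≃ V) {φ : V → V → V ⊕ N}
    {T : V → V → Prop} (hφ : IsHarmoniousScheme φ T) {χ : V → V → C}
    (hχ : IsProperEdgeColouring χ) (l k : ℕ)
    (hl : ∀ u ∈ G.vertexSet, ∀ v ∈ G.vertexSet, u ≠ v → G.edgeMultiplicity u v ≤ l)
    (hk : Fintype.card V + Fintype.card N + (l - 1) * Fintype.card C ≤ k) :
    G.HarmoniouslyTotalColourable k := by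
  obtain ⟨lab, hlab⟩ := G.exists_labelling_of_edgeMultiplicity_le l hl
  let col : Option (Fin (l - 1)) → V → V → (V ⊕ N) ⊕ (Fin (l - 1) × C) := fun i x y =>
    i.elim (.inl (φ x y)) (fun j => .inr (j, χ x y))
  have hcard : Fintype.card ((V ⊕ N) ⊕ (Fin (l - 1) × C)) ≤ Fintype.card (Fin k) := by
    simpa [Fintype.card_sum, Fintype.card_prod] using hk
  obtain ⟨ι⟩ := Function.Embedding.nonempty_of_card_le hcard
  have hends : ∀ e : G.edgeSet, ∃ x y : G.vertexSet, G.IsLink e x y := by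
    intro e
    obtain ⟨x, y, h⟩ := G.exists_isLink_of_mem_edgeSet e.2
    exact ⟨⟨x, h.left_mem⟩, ⟨y, h.right_mem⟩, h⟩
  choose X Y hXY using hends
  let D : G.edgeSet → (V ⊕ N) ⊕ (Fin (l - 1) × C) := fun e => col (lab e) (ν (X e)) (ν (Y e))
  have colsymm : ∀ i x y, col i x y = col i y x := by
    rintro (_ | i) x y
    · simp [col, hφ.symm x y]
    · simp [col, hχ.symm x y]
  have hD : ∀ (e : G.edgeSet) (x y : G.vertexSet), G.IsLink e x y →
      D e = col (lab e) (ν x) (ν y) := by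
    intro e x y h
    rcases (hXY e).eq_and_eq_or_eq_and_eq h with ⟨h1, h2⟩ | ⟨h1, h2⟩
    · rw [← Subtype.ext h1, ← Subtype.ext h2]
    · rw [← Subtype.ext h1, ← Subtype.ext h2, colsymm]
  have hother : ∀ (e : G.edgeSet) (v : G.vertexSet), G.Inc e v →
      ∃ w : G.vertexSet, G.IsLink e v w ∧ v ≠ w := by
    rintro e v ⟨w, h⟩
    exact ⟨⟨w, h.right_mem⟩, h, fun hvw => h.ne (congrArg Subtype.val hvw)⟩
  have hproper : ∀ (e f : G.edgeSet) (v : G.vertexSet), G.Inc e v → G.Inc f v →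
      D e = D f → e = f := by
    intro e f v he hf hef
    obtain ⟨x, hx, hvx⟩ := hother e v he
    obtain ⟨y, hy, hvy⟩ := hother f v hf
    rw [hD e v x hx, hD f v y hy] at hef
    have hvx' : ν v ≠ ν x := ν.injective.ne hvx
    have hvy' : ν v ≠ ν y := ν.injective.ne hvy
    have : lab e = lab f ∧ ν x = ν y := by
      rcases h1 : lab e with _ | i <;> rcases h2 : lab f with _ | j
      · simp only [h1, h2, col, Option.elim, Sum.inl.injEq] at hef
        exact ⟨rfl, hφ.proper _ _ _ hvx' hvy' hef⟩
      · simp [h1, h2, col] at hef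
      · simp [h1, h2, col] at hef
      · simp only [h1, h2, col, Option.elim, Sum.inr.injEq, Prod.mk.injEq] at hef
        exact ⟨by rw [hef.1], hχ.proper _ _ _ hvx' hvy' hef.2⟩
    have hxy := ν.injective this.2
    subst hxy
    exact hlab e f v x hx hy this.1
  have hcov : ∀ (e : G.edgeSet) (v : G.vertexSet) (w : V), G.Inc e v →
      D e = .inl (.inl w) → T w (ν v) := by
    intro e v w he h
    obtain ⟨x, hx, hvx⟩ := hother e v he
    rw [hD e v x hx] at h
    rcases h1 : lab e with _ | i
    · simp only [h1, col, Option.elim, Sum.inl.injEq] at h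
      exact hφ.covers _ _ _ (ν.injective.ne hvx) h
    · simp [h1, col] at h
  refine ⟨fun v => ι (.inl (.inl (ν v))), fun e => ι (D e), ⟨⟨?_, ?_, ?_⟩, ?_⟩⟩
  · rintro u v ⟨e, he⟩ h
    have := ν.injective (Sum.inl_injective (Sum.inl_injective (ι.injective h)))
    exact he.ne (congrArg Subtype.val this)
  · intro e f hef v he hf h
    exact hef (hproper e f v he hf (ι.injective h))
  · intro v e he h
    -- Asymmetry applied to a vertex and itself: no vertex colours an edge at itself.
    have := hcov e v (ν v) he (ι.injective h).symm
    exact hφ.asymm _ _ this this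
  · intro u v e f he hf h
    rcases Sym2.eq_iff.1 h with ⟨h1, h2⟩ | ⟨h1, h2⟩
    · have huv := ν.injective (Sum.inl_injective (Sum.inl_injective (ι.injective h1)))
      subst huv
      exact ⟨rfl, hproper e f u he hf (ι.injective h2)⟩
    -- With the colours swapped, u would colour an edge at v and v an edge at u.
    · exact absurd (hcov f v (ν u) hf (ι.injective h1).symm)
        (hφ.asymm _ _ (hcov e u (ν v) he (ι.injective h2)))

/-! ### Proper edge colourings and two-level schemes -/

/-- The restriction of a proper edge colouring along an injection of the vertices. -/
lemma IsProperEdgeColouring.comap {V W C : Type*} {χ : V → V → C}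
    (h : IsProperEdgeColouring χ) {f : W → V} (hf : f.Injective) :
    IsProperEdgeColouring fun x y => χ (f x) (f y) :=
  ⟨fun _ _ => h.symm _ _, fun _ _ _ hy hz he =>
    hf (h.proper _ _ _ (hf.ne hy) (hf.ne hz) he)⟩

/-- The complete graph on an odd cyclic group and a further point has a proper edge colouring
by the elements of the group. -/
lemma isProperEdgeColouring_option {X : Type*} [AddCommGroup X]
    (h2 : ∀ x y : X, x + x = y + y → x = y) :
    IsProperEdgeColouring fun u v : Option X =>
      u.elim (v.elim 0 fun y => y + y) fun x => v.elim (x + x) fun y => x + y := by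
  constructor
  · rintro (_ | x) (_ | y) <;> simp [add_comm]
  · rintro (_ | x) (_ | y) (_ | z) <;> simp <;> grind

lemma ZMod.eq_of_add_self_eq {p : ℕ} (hp : Odd p) (x y : ZMod p) (h : x + x = y + y) :
    x = y := by
  have h1 : IsUnit ((2 : ℕ) : ZMod p) := (ZMod.isUnit_iff_coprime 2 p).2 (by simpa using hp)
  refine h1.mul_left_cancel ?_
  push_cast
  linear_combination h

theorem exists_isProperEdgeColouring (V : Type*) [Fintype V] (n : ℕ) (hn : 1 ≤ n)
    (hV : Fintype.card V ≤ 2 * n) :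
    ∃ χ : V → V → Fin (2 * n - 1), IsProperEdgeColouring χ := by
  obtain ⟨q, rfl⟩ : ∃ q, n = q + 1 := ⟨n - 1, by omega⟩
  have hq : Odd (2 * q + 1) := ⟨q, rfl⟩
  have h := isProperEdgeColouring_option (ZMod.eq_of_add_self_eq hq)
  obtain ⟨f⟩ : Nonempty (V ↪ Option (ZMod (2 * q + 1))) :=
    Function.Embedding.nonempty_of_card_le (by
      simp only [Fintype.card_option, ZMod.card]; omega)
  -- `ZMod (2 * q + 1)` unfolds to `Fin (2 * (q + 1) - 1)`.
  exact ⟨_, h.comap f.injective⟩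

/-- The edge colouring of the complete graph on `Bool × Y` which is `same` on both levels and
`cross` between the level `false` and the level `true`. -/
def crossColouring {Y N : Type*} (same : Y → Y → N) (cross : Y → Y → (Bool × Y) ⊕ N) :
    Bool × Y → Bool × Y → (Bool × Y) ⊕ N
  | (false, x), (false, y) => .inr (same x y)
  | (true, x), (true, y) => .inr (same x y)
  | (false, x), (true, y) => cross x y
  | (true, x), (false, y) => cross y x

/-- Two edges at a vertex lie both inside its level, both across (`hright`, `hleft`), or one of each
kind (`hsl`, `hsr`). Only cross edges can have vertex colours, so only they matter for `T`. -/
theorem isHarmoniousScheme_crossColouring {Y N : Type*} {same : Y → Y → N}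
    {cross : Y → Y → (Bool × Y) ⊕ N} {T : Bool × Y → Bool × Y → Prop}
    (hsame : IsProperEdgeColouring same)
    (hright : ∀ x y z, cross x y = cross x z → y = z)
    (hleft : ∀ x y z, cross x z = cross y z → x = y)
    (hsl : ∀ x y z, x ≠ z → cross x y ≠ .inr (same x z))
    (hsr : ∀ x y z, y ≠ z → cross x y ≠ .inr (same y z))
    (hcov : ∀ x y w, cross x y = .inl w → T w (false, x) ∧ T w (true, y))
    (hT : ∀ x y, T x y → ¬ T y x) :
    IsHarmoniousScheme (crossColouring same cross) T where
  symm := by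
    rintro ⟨_ | _, x⟩ ⟨_ | _, y⟩ <;> simp [crossColouring, hsame.symm x y]
  proper := by
    rintro ⟨_ | _, x⟩ ⟨_ | _, y⟩ ⟨_ | _, z⟩ hy hz h <;>
      simp only [crossColouring, Sum.inr.injEq, ne_eq, Prod.mk.injEq, true_and, reduceCtorEq,
        false_and, not_false_eq_true] at h hy hz ⊢
    · exact hsame.proper _ _ _ hy hz h
    · exact hsl _ _ _ hy h.symm
    · exact hsl _ _ _ hz h
    · exact hright _ _ _ h
    · exact hleft _ _ _ h
    · exact hsr _ _ _ hz h
    · exact hsr _ _ _ hy h.symm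
    · exact hsame.proper _ _ _ hy hz h
  covers := by
    rintro ⟨_ | _, x⟩ ⟨_ | _, y⟩ w hy h <;> simp only [crossColouring, reduceCtorEq] at h
    · exact (hcov _ _ _ h).1
    · exact (hcov _ _ _ h).2
  asymm := hT

/-- A harmonious scheme extends to one further vertex `none` without new colours if the edges
from `none` to the other vertices `v` can be coloured by different vertices `κ v`. -/
theorem IsHarmoniousScheme.option {V N : Type*} {φ : V → V → V ⊕ N} {T : V → V → Prop}
    (h : IsHarmoniousScheme φ T) (κ : V → V) (hκ : κ.Injective) (hκ2 : ∀ v, κ (κ v) ≠ v)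
    (hT1 : ∀ v, ¬ T (κ v) v) (hT2 : ∀ v, ¬ T v (κ v)) :
    ∃ (φ' : Option V → Option V → Option V ⊕ N) (T' : Option V → Option V → Prop),
      IsHarmoniousScheme φ' T' := by
  -- The value at `none, none` is a dummy. The vertex `none` colours no edge, so every other vertex
  -- may be allowed to colour an edge at it.
  refine ⟨fun u v => u.elim (v.elim (.inl none) fun y => .inl (some (κ y)))
      fun x => v.elim (.inl (some (κ x))) fun y => (φ x y).map some id,
    fun u v => u.elim False fun x => v.elim True fun y => T x y ∨ x = κ y, ⟨⟨?_, ?_⟩, ?_, ?_⟩⟩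
  · rintro (_ | x) (_ | y) <;> simp
    rw [h.symm]
  · rintro (_ | x) (_ | y) (_ | z) hy hz he <;> simp at hy hz he ⊢
    · exact hκ he
    · rcases h1 : φ x z with w | w <;> simp [h1] at he
      subst he
      exact hT1 _ (h.covers _ _ _ hz h1)
    · rcases h1 : φ x y with w | w <;> simp [h1] at he
      subst he
      exact hT1 _ (h.covers _ _ _ hy h1)
    · refine h.proper x y z hy hz ?_
      rcases h1 : φ x y with w | w <;> rcases h2 : φ x z with w' | w' <;> simp_all
  · rintro (_ | x) (_ | y) (_ | w) hy he <;> simp at hy he ⊢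
    · exact Or.inr he.symm
    · rcases h1 : φ x y with w | w <;> simp [h1] at he
    · rcases h1 : φ x y with w' | w' <;> simp [h1] at he
      subst he
      exact Or.inl (h.covers _ _ _ hy h1)
  · rintro (_ | x) (_ | y) <;> simp
    rintro (h1 | rfl)
    · refine ⟨h.asymm _ _ h1, ?_⟩
      rintro rfl
      exact hT2 _ h1
    · exact ⟨hT2 _, fun he => hκ2 _ he.symm⟩

/-! ### Midpoint constructions over a ring in which 2 is invertible -/

section Odd

variable {X : Type*} [CommRing X] {half : X} {pos : X → Bool}

/-- The colour of the edge joining `(false, x)` and `(true, y)`, which lies above the midpoint of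
`x` and `y`, on the level given by the sign of `x - y`. -/
def midColour (half : X) (pos : X → Bool) (x y : X) : Bool × X :=
  (!pos ((x - y) * half), (x + y) * half)

lemma midColour_right_inj (h2 : half + half = 1) {x y z : X}
    (h : midColour half pos x y = midColour half pos x z) : y = z := by
  have := congrArg Prod.snd h
  simp only [midColour] at this
  linear_combination 2 * this + (z - y) * h2

lemma midColour_left_inj (h2 : half + half = 1) {x y z : X}
    (h : midColour half pos x z = midColour half pos y z) : x = y := by
  have := congrArg Prod.snd h
  simp only [midColour] at this
  linear_combination 2 * this + (y - x) * h2

/-- The vertices `u` such that `midColour` uses the colour `v` at `u`. -/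
def MidCovers (pos : X → Bool) (v u : Bool × X) : Prop :=
  u.2 ≠ v.2 ∧ (v.1 = u.1 ↔ pos (u.2 - v.2) = true)

/-- Exchanging the two vertices flips the sign of their difference but not whether their levels
agree. -/
lemma MidCovers.asymm (hpos : ∀ d : X, d ≠ 0 → pos (-d) = !pos d) {u v : Bool × X}
    (h : MidCovers pos u v) : ¬ MidCovers pos v u := by
  obtain ⟨r, x⟩ := u
  obtain ⟨s, y⟩ := v
  simp only [MidCovers, ne_eq] at h ⊢
  have := hpos (y - x) (sub_ne_zero.2 h.1)
  rw [neg_sub] at this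
  rw [this]
  obtain ⟨-, h⟩ := h
  revert h
  cases pos (y - x) <;> cases r <;> cases s <;> simp

/-- Seen from the midpoint, the two ends have opposite differences and lie on opposite levels, so
one choice of level serves both. -/
lemma midCovers_midColour (h2 : half + half = 1) (hpos : ∀ d : X, d ≠ 0 → pos (-d) = !pos d)
    {x y : X} (hxy : x ≠ y) :
    MidCovers pos (midColour half pos x y) (false, x) ∧
      MidCovers pos (midColour half pos x y) (true, y) := by
  have e1 : x - (x + y) * half = (x - y) * half := by linear_combination -x * h2
  have e2 : y - (x + y) * half = -((x - y) * half) := by linear_combination -y * h2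
  have e0 : (x - y) * half ≠ 0 := by
    intro h
    apply hxy
    linear_combination 2 * h - (x - y) * h2
  simp only [MidCovers, midColour, e1, e2, hpos _ e0, ← sub_ne_zero (b := (x + y) * half), ne_eq,
    e0, neg_eq_zero, not_false_eq_true, true_and]
  cases pos ((x - y) * half) <;> simp

lemma eq_of_add_self_eq (h2 : half + half = 1) (x y : X) (h : x + x = y + y) : x = y := by
  linear_combination half * h - (x - y) * h2

/-- A harmonious scheme with `p` new colours on `2 * p` vertices, for odd `p`. -/
theorem exists_isHarmoniousScheme_bool_prod [DecidableEq X] (h2 : half + half = 1)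
    (hpos : ∀ d : X, d ≠ 0 → pos (-d) = !pos d) :
    ∃ (φ : Bool × X → Bool × X → (Bool × X) ⊕ X) (T : Bool × X → Bool × X → Prop),
      IsHarmoniousScheme φ T := by
  refine ⟨_, _, isHarmoniousScheme_crossColouring (same := fun x y => x + y)
    (cross := fun x y => if x = y then .inr (x + x) else .inl (midColour half pos x y))
    (T := MidCovers pos) ⟨fun x y => add_comm _ _, fun x y z _ _ h => add_left_cancel h⟩
    ?_ ?_ ?_ ?_ ?_ fun _ _ h => h.asymm hpos⟩
  · intro x y z h
    split_ifs at h with h1 h3 h3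
    · exact h1.symm.trans h3
    · exact midColour_right_inj h2 (Sum.inl_injective h)
  · intro x y z h
    split_ifs at h with h1 h3 h3
    · exact h1.trans h3.symm
    · exact midColour_left_inj h2 (Sum.inl_injective h)
  · intro x y z hz
    split_ifs with h1
    · simpa using hz
    · simp
  · intro x y z hz
    split_ifs with h1
    · simpa [h1] using hz
    · simp
  · intro x y w h
    split_ifs at h with h1
    obtain rfl := Sum.inl_injective h
    exact midCovers_midColour h2 hpos h1

/-- A harmonious scheme with `p + 1` new colours on `2 * p + 1` vertices, for odd `p ≠ 1`. -/
theorem exists_isHarmoniousScheme_option_bool_prod [DecidableEq X] (h2 : half + half = 1)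
    (hpos : ∀ d : X, d ≠ 0 → pos (-d) = !pos d) {δ : X} (hδ : δ ≠ 0) (hδpos : pos δ = true) :
    ∃ (φ : Option (Bool × X) → Option (Bool × X) → Option (Bool × X) ⊕ Option X)
      (T : Option (Bool × X) → Option (Bool × X) → Prop), IsHarmoniousScheme φ T := by
  have hδδ : δ + δ ≠ 0 := fun h => hδ (by linear_combination half * h - δ * h2)
  -- The cross edges with x - y = 2δ get the new colour `none`. This frees the colour `(false, m)`
  -- at `(false, m + δ)` and at `(true, m - δ)`, as `T` records.
  refine (isHarmoniousScheme_crossColouring (same := fun x y => some (x + y))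
    (cross := fun x y => if x = y then .inr (some (x + x)) else
      if x = y + (δ + δ) then .inr none else .inl (midColour half pos x y))
    (T := fun v u => MidCovers pos v u ∧ ¬ (u.1 = false ∧ u.2 = v.2 + δ) ∧
      ¬ (u.1 = true ∧ u.2 = v.2 - δ))
    ⟨fun x y => by rw [add_comm], fun x y z _ _ h => add_left_cancel (Option.some_injective _ h)⟩
    ?_ ?_ ?_ ?_ ?_ fun _ _ h h' => h.1.asymm hpos h'.1).option
      -- The colour `(true, x - δ)` is already absent at `(false, x)`, by the sign of δ; the freed
      -- class ensures that `(false, x)` in turn colours nothing at `(true, x - δ)`.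
      (fun v => (!v.1, if v.1 then v.2 else v.2 - δ)) ?_ ?_ ?_ ?_
  · intro x y z h
    split_ifs at h with h1 h3 h3 h3 h4 h4 h4 h4
    · exact h1.symm.trans h3
    · simp at h
    · simp at h
    · linear_combination h4 - h3
    · exact midColour_right_inj h2 (Sum.inl_injective h)
  · intro x y z h
    split_ifs at h with h1 h3 h3 h3 h4 h4 h4 h4
    · exact h1.trans h3.symm
    · simp at h
    · simp at h
    · linear_combination h3 - h4
    · exact midColour_left_inj h2 (Sum.inl_injective h)
  · intro x y z hz
    split_ifs with h1
    · simpa using hz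
    · simp
    · simp
  · intro x y z hz
    split_ifs with h1
    · simpa [h1] using hz
    · simp
    · simp
  · intro x y w h
    split_ifs at h with h1 h3
    obtain rfl := Sum.inl_injective h
    obtain ⟨h4, h5⟩ := midCovers_midColour h2 hpos h1
    refine ⟨⟨h4, ?_, by simp⟩, h5, by simp, ?_⟩
    · rintro ⟨-, h⟩
      simp only [midColour] at h
      apply h3
      linear_combination 2 * h + (x + y) * h2
    · rintro ⟨-, h⟩
      simp only [midColour] at h
      apply h3
      linear_combination -2 * h - (x + y) * h2
  · rintro ⟨_ | _, x⟩ ⟨_ | _, y⟩ h <;> simp at h ⊢ <;> exact h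
  · rintro ⟨_ | _, x⟩ <;> simp [hδ]
  · rintro ⟨_ | _, x⟩ <;> simp [MidCovers, hδpos]
  · rintro ⟨_ | _, x⟩ <;> simp [MidCovers]

/-- A harmonious scheme with `p + 1` new colours on `2 * p + 2` vertices, for odd `p`, from the
following data. The permutation `lam` gives a class of edges joining `(false, x)` and
`(true, lam x)`. The vertex `(S x, none)` colours the edge above `x` when that edge is not in the
class. The vertex `F (s, x)` colours the edge from `(s, x)` to `(!s, none)`. -/
theorem exists_isHarmoniousScheme_bool_prod_option [DecidableEq X] (h2 : half + half = 1)
    (hpos : ∀ d : X, d ≠ 0 → pos (-d) = !pos d) (lam : X → X) (hlam : lam.Injective)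
    (S : X → Bool) (F : Bool × X → Bool × X)
    (hF : ∀ s x y, F (s, x) = F (s, y) → x = y)
    (hFS : ∀ u, lam (F u).2 ≠ (F u).2 → S (F u).2 = u.1)
    (hFF : ∀ u, F (F u) ≠ u)
    (hfree : ∀ u v, v = F u ∨ u = F v → MidCovers pos v u →
      if u.1 then lam (v.2 + v.2 - u.2) = u.2 else lam u.2 = v.2 + v.2 - u.2) :
    ∃ (φ : Bool × Option X → Bool × Option X → (Bool × Option X) ⊕ Option X)
      (T : Bool × Option X → Bool × Option X → Prop), IsHarmoniousScheme φ T := by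
  have hsame := isProperEdgeColouring_option (eq_of_add_self_eq h2)
  let up : Bool × X → Bool × Option X := fun v => (v.1, some v.2)
  have hup : ∀ u v, up u = up v → u = v := fun u v h => by
    simp only [up, Prod.mk.injEq, Option.some.injEq] at h
    exact Prod.ext h.1 h.2
  let kept : Bool × X → Bool × X → Prop := fun v u => MidCovers pos v u ∧
    ¬ if u.1 then lam (v.2 + v.2 - u.2) = u.2 else lam u.2 = v.2 + v.2 - u.2
  -- The new colour `none` goes to the class of `lam` and to the edge joining the two further
  -- vertices.
  let cross : Option X → Option X → (Bool × Option X) ⊕ Option X := fun u v =>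
    u.elim (v.elim (.inr none) fun y => .inl (up (F (true, y)))) fun x =>
      v.elim (.inl (up (F (false, x)))) fun y => if y = lam x then .inr none else
        if x = y then .inl (S x, none) else .inl (up (midColour half pos x y))
  let T : Bool × Option X → Bool × Option X → Prop := fun v u =>
    v.2.elim (u.2.elim False fun x => lam x ≠ x ∧ S x = v.1) fun w =>
      u.2.elim (∃ x, F (!u.1, x) = (v.1, w)) fun x => F (u.1, x) = (v.1, w) ∨
        kept (v.1, w) (u.1, x)
  have hmid : ∀ x y, y ≠ lam x → x ≠ y →
      kept (midColour half pos x y) (false, x) ∧ kept (midColour half pos x y) (true, y) := by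
    intro x y hl hxy
    have e1 : (x + y) * half + (x + y) * half - x = y := by linear_combination (x + y) * h2
    have e2 : (x + y) * half + (x + y) * half - y = x := by linear_combination (x + y) * h2
    obtain ⟨h3, h4⟩ := midCovers_midColour (pos := pos) h2 hpos hxy
    refine ⟨⟨h3, ?_⟩, h4, ?_⟩
    · simpa [midColour, e1] using hl.symm
    · simpa [midColour, e2] using hl.symm
  -- The case `v = F u` serves properness at u, where `F u` is already used; `u = F v` serves
  -- asymmetry, as u colours an edge at v.
  have hnk : ∀ u v, v = F u ∨ u = F v → ¬ kept v u := fun u v huv h => h.2 (hfree u v huv h.1)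
  refine ⟨_, T, isHarmoniousScheme_crossColouring (same := fun u v => some (_))
    (cross := cross)
    ⟨fun x y => congrArg some (hsame.symm x y),
      fun x y z hy hz h => hsame.proper x y z hy hz (Option.some_injective _ h)⟩ ?_ ?_ ?_ ?_ ?_ ?_⟩
  · rintro (_ | x) (_ | y) (_ | z) h
    · rfl
    · simp [cross] at h
    · simp [cross] at h
    · simp only [cross, Option.elim, Sum.inl.injEq] at h
      exact congrArg some (hF _ _ _ (hup _ _ h))
    · rfl
    · simp only [cross, Option.elim] at h
      split_ifs at h with h3 h4
      · simp [up] at h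
      · have := hup _ _ (Sum.inl_injective h)
        exact absurd (hmid x z h3 h4).1 (hnk _ _ (.inl this.symm))
    · simp only [cross, Option.elim] at h
      split_ifs at h with h3 h4
      · simp [up] at h
      · have := hup _ _ (Sum.inl_injective h)
        exact absurd (hmid x y h3 h4).1 (hnk _ _ (.inl this))
    · simp only [cross, Option.elim] at h
      split_ifs at h with h3 h4
      all_goals first | (simp [up] at h; done) | skip
      · grind
      · grind
      · exact congrArg some (midColour_right_inj h2 (hup _ _ (Sum.inl_injective h)))
  · rintro (_ | x) (_ | y) (_ | z) h
    · rfl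
    · rfl
    · simp [cross] at h
    · simp only [cross, Option.elim] at h
      split_ifs at h with h3 h4
      · simp [up] at h
      · have := hup _ _ (Sum.inl_injective h)
        exact absurd (hmid y z h3 h4).2 (hnk _ _ (.inl this.symm))
    · simp [cross] at h
    · simp only [cross, Option.elim] at h
      split_ifs at h with h3 h4
      · simp [up] at h
      · have := hup _ _ (Sum.inl_injective h)
        exact absurd (hmid x z h3 h4).2 (hnk _ _ (.inl this))
    · simp only [cross, Option.elim, Sum.inl.injEq] at h
      exact congrArg some (hF _ _ _ (hup _ _ h))
    · simp only [cross, Option.elim] at h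
      split_ifs at h with h3 h4
      all_goals first | (simp [up] at h; done) | skip
      · exact congrArg some (hlam (by grind))
      · grind
      · exact congrArg some (midColour_left_inj h2 (hup _ _ (Sum.inl_injective h)))
  · rintro (_ | x) (_ | y) z - h <;> simp only [cross, Option.elim] at h
    all_goals first | (simp at h) | (split_ifs at h <;> simp at h)
  · rintro (_ | x) (_ | y) z - h <;> simp only [cross, Option.elim] at h
    all_goals first | (simp at h) | (split_ifs at h <;> simp at h)
  · rintro (_ | x) (_ | y) w h
    · simp [cross] at h
    · obtain rfl := Sum.inl_injective h
      exact ⟨⟨y, rfl⟩, .inl rfl⟩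
    · obtain rfl := Sum.inl_injective h
      exact ⟨.inl rfl, ⟨x, rfl⟩⟩
    · simp only [cross, Option.elim] at h
      split_ifs at h with h3 h4
      · obtain rfl := Sum.inl_injective h
        subst h4
        exact ⟨⟨Ne.symm h3, rfl⟩, ⟨Ne.symm h3, rfl⟩⟩
      · obtain rfl := Sum.inl_injective h
        exact ⟨.inr (hmid x y h3 h4).1, .inr (hmid x y h3 h4).2⟩
  -- A further vertex has an edge coloured by `(r, w)`, so it must not itself colour the edge above
  -- w; this is `hFS`.
  · have hinf : ∀ s r x w, F (!s, x) = (r, w) → lam w ≠ w → S w ≠ s := by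
      intro s r x w h h3 h4
      have := hFS (!s, x)
      rw [h] at this
      have := this h3
      simp [h4] at this
    rintro ⟨r, _ | w⟩ ⟨s, _ | x⟩ h h'
    · exact h
    · obtain ⟨y, hy⟩ := h'
      exact hinf _ _ _ _ hy h.1 h.2
    · obtain ⟨y, hy⟩ := h
      exact hinf _ _ _ _ hy h'.1 h'.2
    · rcases h with h | h <;> rcases h' with h' | h'
      · exact hFF (s, x) (by rw [h]; exact h')
      · exact hnk _ _ (.inr h.symm) h'
      · exact hnk _ _ (.inr h'.symm) h
      · exact h.1.asymm hpos h'.1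

end Odd

/-! ### Halves and signs in `ZMod p` -/

lemma ZMod.exists_half {p : ℕ} (hp : Odd p) : ∃ half : ZMod p, half + half = 1 := by
  obtain ⟨h, rfl⟩ := hp
  refine ⟨((h + 1 : ℕ) : ZMod (2 * h + 1)), ?_⟩
  have := ZMod.natCast_self (2 * h + 1)
  push_cast at this ⊢
  linear_combination this

/-- The elements `0, 1, …, (p - 1) / 2` of `ZMod p`. -/
def ZMod.isLowerHalf {p : ℕ} (d : ZMod p) : Bool := decide (2 * d.val < p)

lemma ZMod.isLowerHalf_neg {p : ℕ} (hp : Odd p) (d : ZMod p) (hd : d ≠ 0) :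
    ZMod.isLowerHalf (-d) = !ZMod.isLowerHalf d := by
  obtain ⟨h, rfl⟩ := hp
  have : NeZero d := ⟨hd⟩
  have h1 := ZMod.val_neg_of_ne_zero d
  have h2 := d.val_lt
  simp only [ZMod.isLowerHalf, h1, ← decide_not, decide_eq_decide]
  omega

lemma ZMod.isLowerHalf_natCast {p i : ℕ} (hi : 2 * i < p) :
    ZMod.isLowerHalf (i : ZMod p) = true := by
  simp only [ZMod.isLowerHalf, ZMod.val_natCast_of_lt (show i < p by omega), hi, decide_true]

lemma ZMod.natCast_ne_zero_of_lt {p i : ℕ} (h0 : 0 < i) (hi : i < p) : (i : ZMod p) ≠ 0 := by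
  rw [Ne, ZMod.natCast_eq_zero_iff]
  exact Nat.not_dvd_of_pos_of_lt h0 hi

/-! ### Orders divisible by 4: blocks of three and five -/

/-- The reversal of a block of three (`0, 1, 2`) or of five (`3, …, 7`) consecutive elements. -/
def blockReverse : Fin 8 → Fin 8 := ![2, 1, 0, 7, 6, 5, 4, 3]

/-- The level of the further vertex that colours the edge above an element of a block. -/
def blockLevel : Fin 8 → Bool := ![false, false, true, false, true, false, false, true]

/-- The vertices that colour the edges from the vertices above a block to the further vertices. -/
def blockTarget : Bool → Fin 8 → Bool × Fin 8
  | false => ![(true, 0), (true, 1), (false, 1),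
      (true, 3), (true, 5), (false, 6), (true, 6), (false, 5)]
  | true => ![(false, 1), (true, 2), (false, 2),
      (false, 5), (false, 4), (true, 7), (true, 5), (false, 7)]

/-- Two positions lie in the same block. -/
def SameBlock (i j : Fin 8) : Prop := (3 ≤ i ↔ 3 ≤ j)

instance (i j : Fin 8) : Decidable (SameBlock i j) := by unfold SameBlock; infer_instance

/-- The positions `i` of `u` and `j` of `v` and the levels `s` of `u` and `r` of `v` are such that
the colour `v` of `midColour` is not needed at `u`. -/
def IsFreed (s r : Bool) (i j : Fin 8) : Prop :=
  i = j ∨ (blockReverse i : ℕ) + i = j + j ∨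
    (((i : ℕ) = j + 1 ∨ 3 ≤ j ∧ (i : ℕ) = j + 2) ∧ s ≠ r) ∨
    (((j : ℕ) = i + 1 ∨ 3 ≤ i ∧ (j : ℕ) = i + 2) ∧ s = r)

instance (s r : Bool) (i j : Fin 8) : Decidable (IsFreed s r i j) := by
  unfold IsFreed; infer_instance

/-- `ZMod p` is divided into blocks of three and of five consecutive elements, `t x` being the
position of `x` in its block. -/
lemma ZMod.exists_blocks {p : ℕ} [NeZero p] (q r : ℕ) (hp : p = 5 * r + 3 * q) :
    ∃ t : ZMod p → Fin 8, (∀ x j, SameBlock (t x) j → t (x + ((j : ℕ) - (t x : ℕ))) = j) ∧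
      ∀ x, 3 ≤ t x → 5 ≤ p := by
  -- The r blocks of five come first, with positions 3 to 7; the blocks of three have positions 0 to
  -- 2.
  have ht : ∀ n : ℕ, (if n < 5 * r then 3 + n % 5 else (n - 5 * r) % 3) < 8 := by
    intro n
    split_ifs <;> omega
  refine ⟨fun x => ⟨_, ht x.val⟩, ?_, ?_⟩
  · intro x j hj
    have hx := x.val_lt
    have hj8 := j.2
    obtain ⟨n, hn⟩ : ∃ n, n = x.val := ⟨_, rfl⟩
    have hxn : x = (n : ZMod p) := by rw [hn, ZMod.natCast_zmod_val]
    simp only [SameBlock, Fin.le_def] at hj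
    change (3 ≤ _ ↔ 3 ≤ _) at hj
    rw [← hn] at hj hx
    obtain ⟨m, hm⟩ : ∃ m, m = if n < 5 * r then 3 + n % 5 else (n - 5 * r) % 3 := ⟨_, rfl⟩
    have hmn : m ≤ n + 3 ∧ (n < 5 * r → m = 3 + n % 5) ∧ (¬ n < 5 * r → m = (n - 5 * r) % 3) := by
      split_ifs at hm <;> omega
    rw [← hm] at hj
    have hle : m ≤ n + j := by
      by_cases h : n < 5 * r
      · have := hmn.2.1 h; omega
      · have := hmn.2.2 h; omega
    have hlt : n + j - m < p := by
      by_cases h : n < 5 * r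
      · have := hmn.2.1 h; omega
      · have := hmn.2.2 h; omega
    have hval : (x + (((j : ℕ) : ZMod p) - (m : ℕ))).val = n + j - m := by
      have : x + (((j : ℕ) : ZMod p) - (m : ℕ)) = ((n + j - m : ℕ) : ZMod p) := by
        rw [Nat.cast_sub hle, hxn]
        push_cast
        ring
      rw [this, ZMod.val_natCast_of_lt hlt]
    apply Fin.ext
    simp only [← hn, ← hm, hval]
    by_cases h : n < 5 * r
    · have := hmn.2.1 h
      rw [if_pos] <;> omega
    · have := hmn.2.2 h
      rw [if_neg] <;> omega
  · intro x hx
    simp only [Fin.le_def] at hx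
    change 3 ≤ _ at hx
    split_ifs at hx <;> omega

/-- All the data respect the blocks and depend only on positions. Inside a block the differences
needed are 1 and 2, whose signs do not depend on p, so the conditions reduce to finite checks on the
tables. -/
theorem ZMod.exists_isHarmoniousScheme_of_blocks {p : ℕ} (hp : Odd p) (hp3 : 3 ≤ p) (q r : ℕ)
    (hpqr : p = 5 * r + 3 * q) :
    ∃ (φ : Bool × Option (ZMod p) → Bool × Option (ZMod p) →
        (Bool × Option (ZMod p)) ⊕ Option (ZMod p))
      (T : Bool × Option (ZMod p) → Bool × Option (ZMod p) → Prop), IsHarmoniousScheme φ T := by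
  have : NeZero p := ⟨by omega⟩
  obtain ⟨half, h2⟩ := ZMod.exists_half hp
  obtain ⟨t, ht, ht5⟩ := ZMod.exists_blocks q r hpqr
  let step : ZMod p → Fin 8 → ZMod p := fun x j => x + ((j : ℕ) - (t x : ℕ))
  have hstep : ∀ x j, SameBlock (t x) j → t (step x j) = j := ht
  have hstep2 : ∀ x j k, SameBlock (t x) j → step (step x j) k = step x k := by
    intro x j k h
    have := hstep x j h
    simp only [step] at this ⊢
    rw [this]
    ring
  have hstep0 : ∀ x, step x (t x) = x := by simp [step]
  have hrev : ∀ i, SameBlock i (blockReverse i) ∧ blockReverse (blockReverse i) = i := by decide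
  have htgt : ∀ s i, SameBlock i (blockTarget s i).2 := by decide
  let lam : ZMod p → ZMod p := fun x => step x (blockReverse (t x))
  have hlam : ∀ x, lam (lam x) = x := by
    intro x
    simp only [lam]
    rw [hstep2 _ _ _ (hrev _).1, hstep _ _ (hrev _).1, (hrev _).2, hstep0]
  let F : Bool × ZMod p → Bool × ZMod p := fun u =>
    ((blockTarget u.1 (t u.2)).1, step u.2 (blockTarget u.1 (t u.2)).2)
  have hFt : ∀ u, t (F u).2 = (blockTarget u.1 (t u.2)).2 := fun u => hstep _ _ (htgt _ _)
  have hF1 : ∀ u, (F u).1 = (blockTarget u.1 (t u.2)).1 := fun u => rfl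
  have hpos : ∀ (i j : Fin 8), (3 ≤ i → 5 ≤ p) →
      ((j : ℕ) = i + 1 ∨ 3 ≤ i ∧ (j : ℕ) = i + 2) →
      ZMod.isLowerHalf (((j : ℕ) : ZMod p) - ((i : ℕ) : ZMod p)) = true ∧
      ZMod.isLowerHalf (((i : ℕ) : ZMod p) - ((j : ℕ) : ZMod p)) = false := by
    intro i j h5 hij
    obtain ⟨d, hd0, hd, hji⟩ : ∃ d : ℕ, 0 < d ∧ 2 * d < p ∧ (j : ℕ) = i + d := by
      rcases hij with h | ⟨h3, h⟩
      · exact ⟨1, by omega, by omega, h⟩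
      · exact ⟨2, by omega, by have := h5 h3; omega, h⟩
    have e1 : ((j : ℕ) : ZMod p) - ((i : ℕ) : ZMod p) = (d : ZMod p) := by
      rw [hji]; push_cast; ring
    have h1 := ZMod.isLowerHalf_natCast hd
    refine ⟨by rw [e1, h1], ?_⟩
    rw [← neg_sub, e1, ZMod.isLowerHalf_neg hp _ (ZMod.natCast_ne_zero_of_lt hd0 (by omega)), h1]
    rfl
  have hcore : ∀ u v : Bool × ZMod p, SameBlock (t u.2) (t v.2) →
      u.2 - v.2 = ((t u.2 : ℕ) : ZMod p) - ((t v.2 : ℕ) : ZMod p) → IsFreed u.1 v.1 (t u.2) (t v.2) →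
      MidCovers ZMod.isLowerHalf v u →
      if u.1 then lam (v.2 + v.2 - u.2) = u.2 else lam u.2 = v.2 + v.2 - u.2 := by
    rintro u v hb hd hf ⟨hne, hm⟩
    -- In turn: u and v lie above the same element; reversal sends u to 2v - u, so the edge is in
    -- the class; or the sign of the small difference contradicts the levels.
    rcases hf with h | h | ⟨h, hs⟩ | ⟨h, hs⟩
    · rw [h, sub_self, sub_eq_zero] at hd
      exact absurd hd hne
    · have h1 : lam u.2 = v.2 + v.2 - u.2 := by
        have h' := congrArg (Nat.cast (R := ZMod p)) h
        push_cast at h'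
        simp only [lam, step]
        linear_combination h' + 2 * hd
      split_ifs
      · rw [← h1, hlam]
      · exact h1
    · rw [hd, (hpos _ _ (ht5 _) h).1] at hm
      exact absurd (hm.2 rfl).symm hs
    · rw [hd, (hpos _ _ (ht5 _) h).2] at hm
      exact absurd (hm.1 hs.symm) (by simp)
  have hdec : ∀ s i, IsFreed s (blockTarget s i).1 i (blockTarget s i).2 ∧
      IsFreed (blockTarget s i).1 s (blockTarget s i).2 i := by decide
  refine exists_isHarmoniousScheme_bool_prod_option h2 (ZMod.isLowerHalf_neg hp) lam
    (fun x y h => by rw [← hlam x, h, hlam]) (fun x => blockLevel (t x)) F ?_ ?_ ?_ ?_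
  · intro s x y h
    have hinj : ∀ s, Function.Injective (blockTarget s) := by decide
    have h1 : t x = t y := by
      apply hinj s
      have hfst : (F (s, x)).1 = (F (s, y)).1 := congrArg Prod.fst h
      refine Prod.ext hfst ?_
      rw [← hFt (s, x), ← hFt (s, y), h]
    have h2 := congrArg Prod.snd h
    simp only [F, step, h1] at h2
    exact add_right_cancel h2
  · intro u h
    have hlev : ∀ s i, blockReverse (blockTarget s i).2 ≠ (blockTarget s i).2 →
        blockLevel (blockTarget s i).2 = s := by decide
    rw [hFt]
    apply hlev
    rw [← hFt]
    intro h'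
    apply h
    simp only [lam]
    rw [h', hstep0]
  · intro u h
    have hne : ∀ s i, blockTarget (blockTarget s i).1 (blockTarget s i).2 ≠ (s, i) := by decide
    apply hne u.1 (t u.2)
    rw [← hFt, ← hF1]
    have hfst : (F (F u)).1 = u.1 := congrArg Prod.fst h
    refine Prod.ext hfst ?_
    change (blockTarget (F u).1 (t (F u).2)).2 = t u.2
    rw [← hFt, h]
  · rintro u v (rfl | rfl)
    · refine hcore _ _ ?_ ?_ ?_
      · rw [hFt]; exact htgt _ _
      · rw [hFt]; simp only [F, step]; ring
      · rw [hFt]; exact (hdec _ _).1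
    · refine hcore _ _ ?_ ?_ ?_
      · rw [hFt]; exact (htgt _ _).symm
      · rw [hFt]; simp only [F, step]; ring
      · rw [hFt]; exact (hdec _ _).2

/-- A permutation of `ZMod 7` with two fixed points. -/
def permSeven (x : ZMod 7) : ZMod 7 := (![0, 1, 5, 6, 3, 4, 2] : Fin 7 → ZMod 7) x

/-- Among odd p ≥ 3, only 7 is not a sum of threes and fives; an explicit table replaces the blocks.
The half of 1 modulo 7 is 4. -/
theorem exists_isHarmoniousScheme_sixteen :
    ∃ (φ : Bool × Option (ZMod 7) → Bool × Option (ZMod 7) →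
        (Bool × Option (ZMod 7)) ⊕ Option (ZMod 7))
      (T : Bool × Option (ZMod 7) → Bool × Option (ZMod 7) → Prop), IsHarmoniousScheme φ T := by
  let F : Bool × ZMod 7 → Bool × ZMod 7 := fun u => bif u.1 then
      (![(true, 3), (true, 4), (false, 2), (false, 3), (false, 4), (false, 0), (false, 1)] :
        Fin 7 → Bool × ZMod 7) u.2
    else
      (![(true, 0), (true, 1), (false, 0), (false, 1), (false, 6), (true, 5), (true, 6)] :
        Fin 7 → Bool × ZMod 7) u.2
  refine exists_isHarmoniousScheme_bool_prod_option (half := 4) (by decide)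
    (ZMod.isLowerHalf_neg (by decide)) permSeven (by decide)
    (![true, true, true, true, true, false, false] : Fin 7 → Bool) F ?_ ?_ ?_ ?_
  · decide
  · decide
  · decide
  · unfold MidCovers
    decide

/-! ### Orders 4k + 1: matchings instead of midpoints -/

/-- Two involutions without fixed points have a common proper colouring with two colours. -/
theorem exists_bool_of_involutive {α : Type*} {τ ρ : α → α} (hτ : τ.Involutive)
    (hρ : ρ.Involutive) (hτ' : ∀ a, τ a ≠ a) (hρ' : ∀ a, ρ a ≠ a) :
    ∃ f : α → Bool, ∀ a, f (τ a) = !f a ∧ f (ρ a) = !f a := by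
  let t : Equiv.Perm α := hτ.toPerm
  let r : Equiv.Perm α := hρ.toPerm
  have ht : ∀ a, t a = τ a := fun _ => rfl
  have hr : ∀ a, r a = ρ a := fun _ => rfl
  let g : Equiv.Perm α := t * r
  have htt : t * t = 1 := Equiv.ext hτ
  have hrr : r * r = 1 := Equiv.ext hρ
  have hconj : t * g * t⁻¹ = g⁻¹ := by
    have h1 : t⁻¹ = t := inv_eq_of_mul_eq_one_left htt
    have h2 : r⁻¹ = r := inv_eq_of_mul_eq_one_left hrr
    simp only [g, mul_inv_rev, h1, h2]
    rw [← mul_assoc, htt, one_mul]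
  have hpow : ∀ (m : ℤ) a, t ((g ^ m) a) = (g ^ (-m)) (t a) := by
    intro m a
    have h : t * g ^ m = g ^ (-m) * t := by
      rw [zpow_neg, ← inv_zpow, ← hconj, conj_zpow]
      group
    exact congrArg (fun e : Equiv.Perm α => e a) h
  have hadd : ∀ (m n : ℤ) a, (g ^ (m + n)) a = (g ^ m) ((g ^ n) a) := by
    intro m n a
    rw [zpow_add]
    rfl
  -- If `τ a = g ^ n a`, then for n = 2m the point `g ^ m a` is fixed by `τ`, and for n = 2m + 1 it
  -- is fixed by `ρ`. Hence both involutions exchange the same two distinct cycles of g.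
  have hcyc : ∀ a, ¬ g.SameCycle a (τ a) := by
    rintro a ⟨n, hn⟩
    rw [← ht] at hn
    obtain ⟨m, rfl | rfl⟩ := Int.even_or_odd' n
    · apply hτ' ((g ^ m) a)
      rw [← ht, hpow, ← hn, ← hadd]
      congr 2
      ring
    · apply hρ' ((g ^ m) a)
      apply t.injective
      rw [← hr]
      change g ((g ^ m) a) = _
      rw [hpow, ← hn, ← hadd]
      have := hadd 1 m a
      rw [zpow_one] at this
      rw [← this]
      congr 2
      ring
  classical
  let Q := Quotient (Equiv.Perm.SameCycle.setoid g)
  -- Any order will do: it selects one cycle of each exchanged pair.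
  let _ : LinearOrder Q := linearOrderOfSTO WellOrderingRel
  let cl : α → Q := fun a => Quotient.mk _ a
  have hcl : ∀ a b, cl a = cl b ↔ g.SameCycle a b := fun a b => Quotient.eq
  have hflip : ∀ a b, cl b = cl (τ a) → cl (τ b) = cl a →
      decide (cl b < cl (τ b)) = !decide (cl a < cl (τ a)) := by
    intro a b h1 h2
    have h3 : cl a ≠ cl (τ a) := fun h => hcyc a ((hcl _ _).1 h)
    rw [h1, h2, ← decide_not, decide_eq_decide]
    exact ⟨fun h => h.not_gt, fun h => lt_of_le_of_ne (not_lt.1 h) h3.symm⟩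
  refine ⟨fun a => decide (cl a < cl (τ a)), fun a => ⟨hflip _ _ rfl (by rw [hτ a]), hflip _ _ ?_ ?_⟩⟩
  · rw [hcl]
    refine ⟨1, ?_⟩
    rw [zpow_one]
    change τ (ρ (ρ a)) = τ a
    rw [hρ a]
  · rw [hcl]
    refine Equiv.Perm.SameCycle.symm ⟨1, ?_⟩
    rw [zpow_one]
    rfl

/-- A family of matchings `R w` of `X`, each missing the point `w` and precisely one further point
`x`, which satisfies `q x = w`, such that the edges in none of the matchings form a matching. -/
structure IsMatchingFamily {X : Type*} (R : X → X → X → Prop) (q : X → X) : Prop where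
  symm : ∀ {w x y}, R w x y → R w y x
  right_unique : ∀ {w x y z}, R w x y → R w x z → y = z
  left_unique : ∀ {w w' x y}, R w x y → R w' x y → w = w'
  ne : ∀ {w x y}, R w x y → x ≠ y
  ne_left : ∀ {w x y}, R w x y → x ≠ w
  ne_q : ∀ {w x y}, R w x y → w ≠ q x
  exists_of_ne : ∀ {w x}, x ≠ w → w ≠ q x → ∃ y, R w x y
  eq_of_not_exists : ∀ {x y z}, x ≠ y → x ≠ z → (¬ ∃ w, R w x y) → (¬ ∃ w, R w x z) → y = z
  q_inj : q.Injective
  q_ne : ∀ x, q x ≠ x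

lemma IsMatchingFamily.exists_sign {X : Type*} {R : X → X → X → Prop} {q : X → X}
    (h : IsMatchingFamily R q) {c : X → X} (hc : c.Involutive) (hc' : ∀ x, c x ≠ x)
    (hcq : ∀ x, q (c x) = c (q x)) :
    ∃ pos : X → X → Bool, (∀ w x, w ≠ x → pos x w = !pos w x) ∧
      ∀ w x y, R w x y → pos w y = !pos w x := by
  classical
  have hex : ∀ w x, ∃ y, x ≠ w → w ≠ q x → R w x y := by
    intro w x
    by_cases h1 : x ≠ w ∧ w ≠ q x
    · obtain ⟨y, hy⟩ := h.exists_of_ne h1.1 h1.2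
      exact ⟨y, fun _ _ => hy⟩
    · exact ⟨x, fun h2 h3 => absurd ⟨h2, h3⟩ h1⟩
  choose P hP using hex
  let α := {u : X × X // u.2 ≠ u.1}
  let τ : α → α := fun u => ⟨(u.1.2, u.1.1), u.2.symm⟩
  -- `τ` exchanges w and x, and `ρ` moves x to its partner in `R w`; the sign must flip under both.
  -- If `w = q x` there is no partner, and `c` only serves to make `ρ` a total involution without
  -- fixed points.
  let ρ : α → α := fun u => if hq : u.1.1 = q u.1.2 then
      ⟨(c u.1.1, c u.1.2), hc.injective.ne u.2⟩
    else ⟨(u.1.1, P u.1.1 u.1.2), h.ne_left (h.symm (hP _ _ u.2 hq))⟩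
  have hρ : ρ.Involutive := by
    rintro ⟨⟨w, x⟩, hu⟩
    by_cases hq : w = q x
    · have : c w = q (c x) := by rw [hcq, hq]
      simp only [ρ, hq, dif_pos, hcq, hc _]
    · have h1 := hP w x hu hq
      have h2 := h.ne_q (h.symm h1)
      have h3 := hP w (P w x) (h.ne_left (h.symm h1)) h2
      have h4 := h.right_unique h3 (h.symm h1)
      simp only [ρ, hq, h2, dif_neg, not_false_eq_true, h4]
  obtain ⟨f, hf⟩ := exists_bool_of_involutive (τ := τ) (ρ := ρ) (fun _ => rfl) hρ
    (fun u hu => u.2 (congrArg (fun v : α => v.1.1) hu))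
    (by
      rintro ⟨⟨w, x⟩, hu⟩ he
      by_cases hq : w = q x
      · have := congrArg (fun v : α => v.1.1) he
        simp only [ρ, hq, dif_pos] at this
        exact hc' _ this
      · have := congrArg (fun v : α => v.1.2) he
        simp only [ρ, hq, dif_neg, not_false_eq_true] at this
        exact h.ne (hP w x hu hq) this.symm)
  refine ⟨fun w x => if hx : x ≠ w then f ⟨(w, x), hx⟩ else false, ?_, ?_⟩
  · intro w x hx
    simp only [hx, hx.symm, ne_eq, not_false_eq_true, dif_pos]
    exact (hf ⟨(w, x), hx.symm⟩).1
  · intro w x y hR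
    have h1 := h.ne_left hR
    have h2 := h.ne_left (h.symm hR)
    have h3 := h.ne_q hR
    have h4 := h.right_unique (hP w x h1 h3) hR
    have := (hf ⟨(w, x), h1⟩).2
    simp only [ρ, h3, dif_neg, not_false_eq_true, h4] at this
    simpa only [h1, h2, ne_eq, not_false_eq_true, dif_pos] using this

/-- A harmonious scheme with `p + 1` new colours on `2 * p + 1` vertices, for even `p`. -/
theorem IsMatchingFamily.exists_isHarmoniousScheme {X C : Type*} {R : X → X → X → Prop}
    {q : X → X} (h : IsMatchingFamily R q) {c : X → X} (hc : c.Involutive)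
    (hc' : ∀ x, c x ≠ x) (hcq : ∀ x, q (c x) = c (q x)) {χ : X → X → C}
    (hχ : IsProperEdgeColouring χ) :
    ∃ (φ : Option (Bool × X) → Option (Bool × X) → Option (Bool × X) ⊕ (C ⊕ Bool))
      (T : Option (Bool × X) → Option (Bool × X) → Prop), IsHarmoniousScheme φ T := by
  classical
  obtain ⟨pos, hpos, hposR⟩ := h.exists_sign hc hc' hcq
  -- Of the two additional colours, `false` is for edges above a single point and `true` for those
  -- in no matching.
  let cross : X → X → (Bool × X) ⊕ (C ⊕ Bool) := fun x y =>
    if x = y then .inr (.inr false) else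
      if hw : ∃ w, R w x y then .inl (!pos hw.choose x, hw.choose) else .inr (.inr true)
  have hcross : ∀ x y v, cross x y = .inl v → R v.2 x y ∧ v.1 = !pos v.2 x := by
    intro x y v hv
    simp only [cross] at hv
    split_ifs at hv with h1 h2
    obtain rfl := Sum.inl_injective hv
    exact ⟨h2.choose_spec, rfl⟩
  have hfalse : ∀ x y, cross x y = .inr (.inr false) → x = y := by
    intro x y hv
    simp only [cross] at hv
    split_ifs at hv with h1 h2
    · exact h1
    · simp at hv
  have htrue : ∀ x y, cross x y = .inr (.inr true) → x ≠ y ∧ ¬ ∃ w, R w x y := by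
    intro x y hv
    simp only [cross] at hv
    split_ifs at hv with h1 h2
    · simp at hv
    · exact ⟨h1, h2⟩
  have hC : ∀ x y d, cross x y ≠ .inr (.inl d) := by
    intro x y d
    simp only [cross]
    split_ifs <;> simp
  have hRcomm : ∀ x y, (¬ ∃ w, R w x y) → ¬ ∃ w, R w y x := fun x y hn ⟨w, hw⟩ =>
    hn ⟨w, h.symm hw⟩
  refine (isHarmoniousScheme_crossColouring (same := fun x y => Sum.inl (χ x y))
    (cross := cross) (T := fun v u => (∃ y, R v.2 u.2 y) ∧ (v.1 = u.1 ↔ pos v.2 u.2 = true))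
    ⟨fun x y => congrArg _ (hχ.symm x y),
      fun x y z hy hz he => hχ.proper x y z hy hz (Sum.inl_injective he)⟩
    ?_ ?_ (fun _ _ _ _ => hC _ _ _) (fun _ _ _ _ => hC _ _ _) ?_ ?_).option
      -- Since `R (q x)` misses x, both vertices above `q x` are unused at x. The level is chosen so
      -- that v does not colour an edge at `κ v`.
      (fun v => (v.1 ^^ !pos (q v.2) v.2, q v.2)) ?_ ?_ ?_ ?_
  · intro x y z he
    rcases h1 : cross x y with v | d | _ | _
    · exact h.right_unique (hcross _ _ _ h1).1 (hcross _ _ _ (he ▸ h1)).1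
    · exact absurd h1 (hC _ _ _)
    · exact (hfalse _ _ h1).symm.trans (hfalse _ _ (he ▸ h1))
    · obtain ⟨h2, h3⟩ := htrue _ _ h1
      obtain ⟨h4, h5⟩ := htrue _ _ (he ▸ h1)
      exact h.eq_of_not_exists h2 h4 h3 h5
  · intro x y z he
    rcases h1 : cross x z with v | d | _ | _
    · exact h.right_unique (h.symm (hcross _ _ _ h1).1) (h.symm (hcross _ _ _ (he ▸ h1)).1)
    · exact absurd h1 (hC _ _ _)
    · exact (hfalse _ _ h1).trans (hfalse _ _ (he ▸ h1)).symm
    · obtain ⟨h2, h3⟩ := htrue _ _ h1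
      obtain ⟨h4, h5⟩ := htrue _ _ (he ▸ h1)
      exact h.eq_of_not_exists h2.symm h4.symm (hRcomm _ _ h3) (hRcomm _ _ h5)
  · intro x y v hv
    obtain ⟨h1, h2⟩ := hcross x y v hv
    refine ⟨⟨⟨y, h1⟩, ?_⟩, ⟨x, h.symm h1⟩, ?_⟩
    · rw [h2]; simp
    · rw [hposR _ _ _ h1, h2]
  · rintro ⟨r, x⟩ ⟨s, y⟩ ⟨⟨z, hz⟩, h1⟩ ⟨-, h2⟩
    have h3 := hpos x y (h.ne_left hz).symm
    simp only [h3] at h1 h2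
    revert h1 h2
    cases pos x y <;> cases r <;> cases s <;> simp
  · rintro ⟨r, x⟩ ⟨s, y⟩ he
    simp only [Prod.mk.injEq] at he
    obtain rfl := h.q_inj he.2
    simpa using he.1
  · rintro ⟨r, x⟩ he
    simp only [Prod.mk.injEq] at he
    obtain ⟨h1, h2⟩ := he
    have h3 := hpos (q x) x (h.q_ne x)
    rw [h2, h3] at h1
    revert h1
    cases pos (q x) x <;> cases r <;> simp
  · rintro ⟨r, x⟩ ⟨⟨y, hy⟩, -⟩
    exact h.ne_q hy rfl
  · rintro ⟨r, x⟩ ⟨-, h1⟩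
    have h3 := hpos (q x) x (h.q_ne x)
    simp only [h3] at h1
    revert h1
    cases pos (q x) x <;> cases r <;> simp

/-- Two offsets from `w` of vertices joined in the matching with index `w` of `ZMod (2 * k)`. -/
def IsOffsetPair (k i j : ℕ) : Prop :=
  1 ≤ i ∧ 1 ≤ j ∧ ((i + j = 2 * k ∧ (i ≤ (k - 1) / 2 ∨ j ≤ (k - 1) / 2)) ∨
    (i + j + 1 = 2 * k ∧ (k - 1) / 2 < i ∧ (k - 1) / 2 < j))

lemma ZMod.eq_or_of_natCast_eq {N a b : ℕ} (h : (a : ZMod N) = b) (ha : a < 2 * N)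
    (hb : b < 2 * N) : a = b ∨ a = b + N ∨ b = a + N := by
  rw [ZMod.natCast_eq_natCast_iff] at h
  obtain ⟨t, ht⟩ := h.dvd
  have h1 : t < 2 := by
    by_contra! h'
    nlinarith
  have h2 : -2 < t := by
    by_contra! h'
    nlinarith
  interval_cases t <;> omega

/-- Let h = (k - 1) / 2. The offsets 1, …, h are paired with their negatives, and h + 1, …, 2k - 2 -
h among themselves with sum 2k - 1. This omits 0 and 2k - 1 - h = -(h + 1), whence `q`. The first
kind gives even differences and the second odd ones. Each difference except 0 and k occurs once, so
the unmatched edges join antipodes. -/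
theorem ZMod.isMatchingFamily (k : ℕ) (hk : 1 ≤ k) :
    IsMatchingFamily (X := ZMod (2 * k))
      (fun w x y => ∃ i j : ℕ, IsOffsetPair k i j ∧ x = w + i ∧ y = w + j)
      (fun x => x + ((k - 1) / 2 + 1 : ℕ)) := by
  have : NeZero (2 * k) := ⟨by omega⟩
  have hself : ((2 * k : ℕ) : ZMod (2 * k)) = 0 := ZMod.natCast_self _
  have hlt : ∀ {i j}, IsOffsetPair k i j → i < 2 * k ∧ j < 2 * k := by
    intro i j h
    unfold IsOffsetPair at h
    omega
  have hinj : ∀ {i j : ℕ}, (i : ZMod (2 * k)) = j → i < 2 * k → j < 2 * k → i = j := by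
    intro i j h hi hj
    rcases ZMod.eq_or_of_natCast_eq h (by omega) (by omega) with h | h | h <;> omega
  have hne0 : ∀ {i : ℕ}, 0 < i → i < 4 * k → i ≠ 2 * k → (i : ZMod (2 * k)) ≠ 0 := by
    intro i h0 h1 h2 h
    rw [← Nat.cast_zero] at h
    rcases ZMod.eq_or_of_natCast_eq h (by omega) (by omega) with h | h | h <;> omega
  constructor
  · rintro w x y ⟨i, j, h, rfl, rfl⟩
    exact ⟨j, i, by unfold IsOffsetPair at h ⊢; omega, rfl, rfl⟩
  · rintro w x y z ⟨i, j, h, rfl, rfl⟩ ⟨i', j', h', h1, rfl⟩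
    have := hinj (add_left_cancel h1) (hlt h).1 (hlt h').1
    have : j = j' := by unfold IsOffsetPair at h h'; omega
    rw [this]
  · rintro w w' x y ⟨i, j, h, rfl, rfl⟩ ⟨i', j', h', h1, h2⟩
    have hij : ((i + j' : ℕ) : ZMod (2 * k)) = ((i' + j : ℕ) : ZMod (2 * k)) := by
      push_cast
      linear_combination h1 - h2
    have hi := hlt h
    have hi' := hlt h'
    have := ZMod.eq_or_of_natCast_eq hij (by omega) (by omega)
    have : i = i' := by
      unfold IsOffsetPair at h h'
      omega
    rw [this] at h1
    exact add_right_cancel h1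
  · rintro w x y ⟨i, j, h, rfl, rfl⟩ he
    have := hinj (add_left_cancel he) (hlt h).1 (hlt h).2
    unfold IsOffsetPair at h
    omega
  · rintro w x y ⟨i, j, h, rfl, rfl⟩ he
    rw [add_eq_left] at he
    have := (hlt h).1
    refine hne0 ?_ ?_ ?_ he <;> unfold IsOffsetPair at h <;> omega
  · rintro w x y ⟨i, j, h, rfl, rfl⟩ he
    rw [add_assoc, left_eq_add, ← Nat.cast_add] at he
    have := (hlt h).1
    refine hne0 ?_ ?_ ?_ he <;> unfold IsOffsetPair at h <;> omega
  · intro w x hx hq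
    obtain ⟨i, hi⟩ : ∃ i, i = (x - w).val := ⟨_, rfl⟩
    have hxi : x = w + i := by
      rw [hi, ZMod.natCast_zmod_val]
      ring
    have hi2 : i < 2 * k := hi ▸ ZMod.val_lt _
    have hi0 : i ≠ 0 := by
      rintro rfl
      simp at hxi
      exact hx hxi
    have hiq : i + ((k - 1) / 2 + 1) ≠ 2 * k := by
      intro he
      apply hq
      rw [hxi, add_assoc, ← Nat.cast_add, he, hself, add_zero]
    by_cases h1 : i ≤ (k - 1) / 2 ∨ 2 * k ≤ i + (k - 1) / 2
    · exact ⟨_, i, 2 * k - i, by unfold IsOffsetPair; omega, hxi, rfl⟩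
    · exact ⟨_, i, 2 * k - 1 - i, by unfold IsOffsetPair; omega, hxi, rfl⟩
  · have hoff : ∀ D, 1 ≤ D → D < 2 * k → D ≠ k →
        ∃ i j, IsOffsetPair k i j ∧ (i = j + D ∨ i + 2 * k = j + D) := by
      intro D h1 h2 h3
      unfold IsOffsetPair
      obtain ⟨d, rfl | rfl⟩ := Nat.even_or_odd' D
      · by_cases h4 : d ≤ (k - 1) / 2
        · exact ⟨d, 2 * k - d, by omega, by omega⟩
        · exact ⟨d + k, k - d, by omega, by omega⟩
      · by_cases h4 : (k - 1) / 2 < d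
        · exact ⟨d, 2 * k - 1 - d, by omega, by omega⟩
        · exact ⟨d + k, k - 1 - d, by omega, by omega⟩
    have key : ∀ x y : ZMod (2 * k), x ≠ y →
        (¬ ∃ w, ∃ i j : ℕ, IsOffsetPair k i j ∧ x = w + i ∧ y = w + j) → x - y = (k : ℕ) := by
      intro x y hxy hn
      obtain ⟨D, hD⟩ : ∃ D, D = (x - y).val := ⟨_, rfl⟩
      have hD' : x - y = D := by rw [hD, ZMod.natCast_zmod_val]
      have hD2 : D < 2 * k := hD ▸ ZMod.val_lt _
      have hD0 : D ≠ 0 := by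
        rintro rfl
        rw [Nat.cast_zero, sub_eq_zero] at hD'
        exact hxy hD'
      by_contra hDk
      obtain ⟨i, j, hij, h⟩ := hoff D (by omega) hD2 (fun h => hDk (h ▸ hD'))
      refine hn ⟨x - i, i, j, hij, by ring, ?_⟩
      have : (i : ZMod (2 * k)) = j + D := by
        rcases h with h | h
        · exact_mod_cast congrArg (Nat.cast (R := ZMod (2 * k))) h
        · have := congrArg (Nat.cast (R := ZMod (2 * k))) h
          rw [Nat.cast_add, hself, add_zero] at this
          exact_mod_cast this
      rw [this, ← hD']
      ring
    intro x y z hy hz h1 h2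
    have := (key x y hy h1).trans (key x z hz h2).symm
    linear_combination -this
  · exact add_left_injective _
  · intro x he
    rw [add_eq_left] at he
    refine hne0 ?_ ?_ ?_ he <;> omega

/-! ### All orders, and the bound -/

/-- This is p = 1, where no nonzero δ exists. -/
lemma isHarmoniousScheme_three :
    IsHarmoniousScheme (fun x y : Fin 3 => if x + y = 1 then Sum.inl (2 : Fin 3) else
      .inr (if x + y = 2 then (0 : Fin 2) else 1)) (fun w x => w = 2 ∧ x ≠ 2) where
  symm := by decide
  proper := by decide
  covers := by decide
  asymm := by decide

/-- The complete graph of order `n ≠ 4` has a harmonious scheme with `⌈n / 2⌉` new colours. -/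
theorem exists_isHarmoniousScheme (n : ℕ) (hn : 2 ≤ n) (hn4 : n ≠ 4) :
    ∃ (V N : Type) (_ : Fintype V) (_ : Fintype N) (φ : V → V → V ⊕ N) (T : V → V → Prop),
      Fintype.card V = n ∧ Fintype.card N = (n + 1) / 2 ∧ IsHarmoniousScheme φ T := by
  obtain ⟨k, hk⟩ : ∃ k, n = 4 * k ∨ n = 4 * k + 1 ∨ n = 4 * k + 2 ∨ n = 4 * k + 3 :=
    ⟨n / 4, by omega⟩
  rcases hk with rfl | rfl | rfl | rfl
  · obtain ⟨p, hp⟩ : ∃ p, p + 1 = 2 * k := ⟨2 * k - 1, by omega⟩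
    have hodd : Odd p := ⟨k - 1, by omega⟩
    have : NeZero p := ⟨by omega⟩
    have key : ∃ (φ : Bool × Option (ZMod p) → Bool × Option (ZMod p) →
        (Bool × Option (ZMod p)) ⊕ Option (ZMod p))
        (T : Bool × Option (ZMod p) → Bool × Option (ZMod p) → Prop),
        IsHarmoniousScheme φ T := by
      by_cases h7 : p = 7
      · subst h7
        exact exists_isHarmoniousScheme_sixteen
      · have : ∃ q r, p = 5 * r + 3 * q := by
          obtain ⟨q, hq⟩ : ∃ q, p = 3 * q ∨ p = 3 * q + 1 ∨ p = 3 * q + 2 := ⟨p / 3, by omega⟩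
          rcases hq with hq | hq | hq
          · exact ⟨q, 0, by omega⟩
          -- Here q ≥ 4, as p is odd, at least 3 and not 7.
          · exact ⟨q - 3, 2, by omega⟩
          · exact ⟨q - 1, 1, by omega⟩
        obtain ⟨q, r, h⟩ := this
        exact ZMod.exists_isHarmoniousScheme_of_blocks hodd (by omega) q r h
    obtain ⟨φ, T, h⟩ := key
    refine ⟨_, _, inferInstance, inferInstance, φ, T, ?_, ?_, h⟩ <;>
      simp only [Fintype.card_prod, Fintype.card_bool, Fintype.card_option, ZMod.card] <;> omega
  · have : NeZero (2 * k) := ⟨by omega⟩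
    have hcast : ((k : ℕ) : ZMod (2 * k)) + (k : ℕ) = 0 := by
      rw [← Nat.cast_add, ← two_mul, ZMod.natCast_self]
    obtain ⟨χ, hχ⟩ := exists_isProperEdgeColouring (ZMod (2 * k)) k (by omega)
      (by rw [ZMod.card])
    obtain ⟨φ, T, h⟩ := (ZMod.isMatchingFamily k (by omega)).exists_isHarmoniousScheme
      (c := fun x => x + (k : ℕ)) (fun x => by linear_combination hcast)
      (fun x hx => ZMod.natCast_ne_zero_of_lt (p := 2 * k) (i := k) (by omega) (by omega)
        (by simpa using hx))
      (fun x => by ring) hχ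
    refine ⟨_, _, inferInstance, inferInstance, φ, T, ?_, ?_, h⟩ <;>
      simp only [Fintype.card_prod, Fintype.card_bool, Fintype.card_option, ZMod.card,
        Fintype.card_sum, Fintype.card_fin] <;> omega
  · have hodd : Odd (2 * k + 1) := ⟨k, rfl⟩
    obtain ⟨half, h2⟩ := ZMod.exists_half hodd
    obtain ⟨φ, T, h⟩ := exists_isHarmoniousScheme_bool_prod h2 (ZMod.isLowerHalf_neg hodd)
    refine ⟨_, _, inferInstance, inferInstance, φ, T, ?_, ?_, h⟩ <;>
      simp only [Fintype.card_prod, Fintype.card_bool, ZMod.card] <;> omega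
  · rcases Nat.eq_zero_or_pos k with rfl | hk
    · exact ⟨_, _, inferInstance, inferInstance, _, _, by simp, by simp,
        isHarmoniousScheme_three⟩
    · have hodd : Odd (2 * k + 1) := ⟨k, rfl⟩
      obtain ⟨half, h2⟩ := ZMod.exists_half hodd
      obtain ⟨φ, T, h⟩ := exists_isHarmoniousScheme_option_bool_prod h2
        (ZMod.isLowerHalf_neg hodd) (δ := (1 : ℕ))
        (ZMod.natCast_ne_zero_of_lt one_pos (by omega)) (ZMod.isLowerHalf_natCast (by omega))
      refine ⟨_, _, inferInstance, inferInstance, φ, T, ?_, ?_, h⟩ <;>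
        simp only [Fintype.card_prod, Fintype.card_bool, Fintype.card_option, ZMod.card] <;>
        omega

lemma Graph.HarmoniouslyTotalColourable.exists_chromaticNumber_eq {α β : Type*} {G : Graph α β}
    {k : ℕ} (h : G.HarmoniouslyTotalColourable k) :
    ∃ m : ℕ, G.harmoniousTotalChromaticNumber = (m : ℕ∞) ∧ m ≤ k := by
  have hle : G.harmoniousTotalChromaticNumber ≤ (k : ℕ∞) := iInf₂_le k h
  obtain ⟨m, hm⟩ := ENat.ne_top_iff_exists.1 (ne_top_of_le_ne_top (ENat.natCast_ne_top k) hle)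
  refine ⟨m, hm.symm, ?_⟩
  rw [← hm] at hle
  exact_mod_cast hle

lemma Graph.harmoniouslyTotalColourable_one {α β : Type*} (G : Graph α β) [G.Loopless]
    (h : ∀ u ∈ G.vertexSet, ∀ v ∈ G.vertexSet, u ≠ v → G.edgeMultiplicity u v ≤ (0 : ℕ)) :
    G.HarmoniouslyTotalColourable 1 := by
  have hno : ∀ e u v, ¬ G.IsLink e u v := by
    intro e u v he
    have h0 := h u he.left_mem v he.right_mem he.ne
    rw [Nat.cast_zero, nonpos_iff_eq_zero, Graph.edgeMultiplicity, Set.encard_eq_zero] at h0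
    have : e ∈ {e : β | G.IsLink e u v} := he
    rw [h0] at this
    exact this
  refine ⟨fun _ => 0, fun _ => 0, ⟨⟨?_, ?_, ?_⟩, ?_⟩⟩
  · rintro u v ⟨e, he⟩
    exact absurd he (hno _ _ _)
  · rintro e f - v ⟨w, he⟩
    exact absurd he (hno _ _ _)
  · rintro v e ⟨w, he⟩
    exact absurd he (hno _ _ _)
  · rintro u v e f ⟨w, he⟩
    exact absurd he (hno _ _ _)

lemma Rat.ceil_natCast_div_two (n : ℕ) : ⌈(n : ℚ) / 2⌉ = ((n + 1) / 2 : ℕ) := by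
  obtain ⟨m, rfl | rfl⟩ := Nat.even_or_odd' n
  · have : (2 * m + 1) / 2 = m := by omega
    rw [this, Int.ceil_eq_iff]
    push_cast
    constructor <;> linarith
  · have : (2 * m + 1 + 1) / 2 = m + 1 := by omega
    rw [this, Int.ceil_eq_iff]
    push_cast
    constructor <;> linarith

theorem mainTheorem4 {α β : Type*} (G : Graph α β) [G.Loopless] (n l : ℕ)
    (hn : 2 ≤ n) (hn4 : n ≠ 4) (horder : G.vertexSet.ncard = n)
    (hl : G.IsMaxEdgeMultiplicity (l : ℕ∞)) :
    ∃ h : ℕ, G.harmoniousTotalChromaticNumber = (h : ℕ∞) ∧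
      (h : ℤ) ≤ ((l : ℤ) - 1) * (2 * ⌈(n : ℚ) / 2⌉ - 1) + ⌈3 * (n : ℚ) / 2⌉ := by
  have hmult : ∀ u ∈ G.vertexSet, ∀ v ∈ G.vertexSet, u ≠ v → G.edgeMultiplicity u v ≤ l :=
    fun u hu v hv huv => hl.2 ⟨u, hu, v, hv, huv, rfl⟩
  have hc3 : ⌈3 * (n : ℚ) / 2⌉ = n + ((n + 1) / 2 : ℕ) := by
    rw [← Rat.ceil_natCast_div_two, ← Int.ceil_natCast_add]
    congr 1
    ring
  rw [hc3, Rat.ceil_natCast_div_two]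
  obtain ⟨c, hc⟩ : ∃ c, c = (n + 1) / 2 := ⟨_, rfl⟩
  rw [← hc]
  rcases l with _ | l
  -- Without edges the bound is n - c + 1 ≥ 1, and one colour suffices.
  · obtain ⟨m, hm, hm1⟩ := (G.harmoniouslyTotalColourable_one hmult).exists_chromaticNumber_eq
    refine ⟨m, hm, ?_⟩
    push_cast
    omega
  · obtain ⟨V, N, _, _, φ, T, hV, hN, hφ⟩ := exists_isHarmoniousScheme n hn hn4
    obtain ⟨χ, hχ⟩ := exists_isProperEdgeColouring V c (by omega) (by omega)
    have hfin : G.vertexSet.Finite := Set.finite_of_ncard_ne_zero (by omega)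
    have := hfin.fintype
    have hcard : Fintype.card G.vertexSet = Fintype.card V := by
      rw [hV, ← horder, ← Nat.card_coe_set_eq, Nat.card_eq_fintype_card]
    obtain ⟨m, hm, hmk⟩ := (G.harmoniouslyTotalColourable_of_scheme (Fintype.equivOfCardEq hcard)
      hφ hχ (l + 1) _ hmult le_rfl).exists_chromaticNumber_eq
    refine ⟨m, hm, ?_⟩
    rw [hV, hN, Fintype.card_fin, ← hc, Nat.add_sub_cancel] at hmk
    have h1 : ((2 * c - 1 : ℕ) : ℤ) = 2 * c - 1 := by omega
    have h2 : (m : ℤ) ≤ ((n + c + l * (2 * c - 1) : ℕ) : ℤ) := by exact_mod_cast hmk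
    rw [Nat.cast_add, Nat.cast_mul, h1] at h2
    push_cast at h2 ⊢
    linarith
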